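/- All games are finite partizan game forms $\{G^L \mid G^R\}$ under mis\`ere play, where (as in Siegel's augmented forms) any subposition may additionally carry a Left and/or a Right tombstone; ordinary forms are those without tombstones. A form is Left end-like if Left has no options or there is a Left tombstone; Left, moving first on $G$, wins if $G$ is Left end-like or if she has an option on which Right, moving first, does not win (symmetrically for Right). The outcome $\mathrm{o}(G)$ is $\mathscr L$, $\mathscr N$, $\mathscr P$ or $\mathscr R$, partially ordered by $\mathscr R<\mathscr N,\mathscr P<\mathscr L$. A sum $G+H$ has a Left tombstone iff both summands are Left end-like and at least one has a Left tombstone (similarly for Right); $\overline G$ is the conjugate of $G$, in which the roles of Left and Right are exchanged. For a set of games $\mathcal A$, write $G\geq_{\mathcal A}H$ if $\mathrm{o}(G+X)\geq\mathrm{o}(H+X)$ for all $X\in\mathcal A$, and $G\equiv_{\mathcal A}H$ if $G\geq_{\mathcal A}H\geq_{\mathcal A}G$. A game is $\mathscr P$-free if none of its subpositions (itself included) has outcome $\mathscr P$. Let $\mathrm{PF}(\mathcal A)$ be the set of $\mathscr P$-free elements of $\mathcal A$, and let $\mathrm{PF}_{\mathcal A}(\mathcal A)$ be the set of those $G\in\mathcal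 A$ such that $G\equiv_{\mathcal A}H$ for some $H\in\mathrm{PF}(\mathcal A)$. Let $\mathcal A^\times$ be the set of $G\in\mathcal A$ with $G+H\equiv_{\mathcal A}0$ for some $H\in\mathcal A$, and $\mathcal A^{\overline\times}$ the set of $G\in\mathcal A$ with $\overline G\in\mathcal A$ and $G+\overline G\equiv_{\mathcal A}0$. For $\mathcal P,\mathcal Q\subseteq\mathcal A$, write $\mathcal P\leq\mathcal Q$ (modulo $\mathcal A$) if $\mathcal P\subseteq\mathcal Q$ and the classes of the elements of $\mathcal P$ modulo $\equiv_{\mathcal A}$ form a group under addition with identity the class of $0$. A monoid of games is an additively closed set $\mathcal A$ of games containing some $E$ with $E+X\equiv_{\mathcal A}X$ for all $X\in\mathcal A$. A universe is a nonempty set of games that is closed under addition, under taking options and under conjugation, and that contains $\{\mathcal G\mid\mathcal H\}$ for all nonempty finite subsets $\mathcal G,\mathcal H$ of it. **Corollary.** Let $\mathcal U$ be a universe such that $\mathrm{PF}(\mathcal U)\leq\mathcal U^\times$ or $\mathrm{PF}_{\mathcal U}(\mathcal U)\leq\mathcal U^\times$ (modulo $\mathcal U$), and let $\mathcal A\subseteq\mathcal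 U$ be a conjugate-closed monoid of games. Then 1. either $\mathrm{PF}(\mathcal A)=\emptyset$, or $\mathrm{PF}(\mathcal A)$ is closed under addition and $\mathrm{PF}(\mathcal A)\leq\mathcal A^{\overline\times}$ (modulo $\mathcal A$); and 2. either $\mathrm{PF}_{\mathcal A}(\mathcal A)=\emptyset$, or $\mathrm{PF}_{\mathcal A}(\mathcal A)$ is closed under addition and $\mathrm{PF}_{\mathcal A}(\mathcal A)\leq\mathcal A^{\overline\times}$ (modulo $\mathcal A$). -/

import Mathlib

noncomputable section

namespace Misere

open scoped Classical

/-! ### Augmented game forms -/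

/-- The data from which an augmented form is built: a finite set of Left options, a finite set of
Right options, and whether there is a Left (respectively Right) tombstone. -/
@[ext]
structure Data (α : Type) : Type where
  left : Finset α
  right : Finset α
  leftTomb : Prop
  rightTomb : Prop

/-- `Data` as a quotient of a polynomial functor, with options enumerated by `Fin m` and `Fin n`. -/
instance : QPF Data where
  map f x := ⟨x.left.image f, x.right.image f, x.leftTomb, x.rightTomb⟩
  P := ⟨(ℕ × ℕ) × (Prop × Prop), fun a => Fin a.1.1 ⊕ Fin a.1.2⟩
  abs := fun ⟨a, g⟩ => ⟨Finset.univ.image fun i => g (Sum.inl i),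
    Finset.univ.image fun i => g (Sum.inr i), a.2.1, a.2.2⟩
  repr x := ⟨((x.left.card, x.right.card), (x.leftTomb, x.rightTomb)),
    Sum.elim (fun i => (x.left.equivFin.symm i).1) (fun i => (x.right.equivFin.symm i).1)⟩
  abs_repr x := by
    ext y
    · simp only [Finset.mem_image, Finset.mem_univ, true_and, Sum.elim_inl]
      exact ⟨by rintro ⟨i, rfl⟩; exact (x.left.equivFin.symm i).2,
        fun h => ⟨x.left.equivFin ⟨y, h⟩, by simp⟩⟩
    · simp only [Finset.mem_image, Finset.mem_univ, true_and, Sum.elim_inr]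
      exact ⟨by rintro ⟨i, rfl⟩; exact (x.right.equivFin.symm i).2,
        fun h => ⟨x.right.equivFin ⟨y, h⟩, by simp⟩⟩
    · rfl
    · rfl
  abs_map f p := by
    obtain ⟨a, g⟩ := p
    simp only [PFunctor.map, Finset.image_image]
    rfl

/-- Augmented forms of finite partizan games: every form is `{tombstone?, Gᴸ | Gᴿ, tombstone?}`
for unique finite sets of forms `Gᴸ`, `Gᴿ`, and the construction is well-founded. Two forms are
equal exactly when they are isomorphic. -/
def Form : Type := QPF.Fix Data

namespace Form

/-- The form with the given options and tombstones. -/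
def mk (x : Data Form) : Form := QPF.Fix.mk x

/-- The options and tombstones of a form. -/
def dest (G : Form) : Data Form := QPF.Fix.dest G

theorem mk_dest (G : Form) : mk G.dest = G := QPF.Fix.mk_dest G

theorem dest_mk (x : Data Form) : (mk x).dest = x := QPF.Fix.dest_mk x

/-- The set of Left options. -/
def left (G : Form) : Finset Form := G.dest.left

/-- The set of Right options. -/
def right (G : Form) : Finset Form := G.dest.right

/-- `G` has a Left tombstone. -/
def LeftTomb (G : Form) : Prop := G.dest.leftTomb

/-- `G` has a Right tombstone. -/
def RightTomb (G : Form) : Prop := G.dest.rightTomb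

@[simp] theorem left_mk (x : Data Form) : (mk x).left = x.left := by rw [left, dest_mk]

@[simp] theorem right_mk (x : Data Form) : (mk x).right = x.right := by rw [right, dest_mk]

@[simp] theorem leftTomb_mk (x : Data Form) : (mk x).LeftTomb = x.leftTomb := by
  rw [LeftTomb, dest_mk]

@[simp] theorem rightTomb_mk (x : Data Form) : (mk x).RightTomb = x.rightTomb := by
  rw [RightTomb, dest_mk]

theorem ext {G H : Form} (hl : G.left = H.left) (hr : G.right = H.right)
    (htl : G.LeftTomb ↔ H.LeftTomb) (htr : G.RightTomb ↔ H.RightTomb) : G = H := by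
  rw [← mk_dest G, ← mk_dest H]
  exact congrArg mk (Data.ext hl hr (propext htl) (propext htr))

/-- `G'` is an option (Left or Right) of `G`. -/
def IsOption (G' G : Form) : Prop := G' ∈ G.left ∨ G' ∈ G.right

theorem induction {p : Form → Prop} (h : ∀ G, (∀ G', IsOption G' G → p G') → p G) (G : Form) :
    p G := by
  refine QPF.Fix.ind (F := Data) p (fun x hx => ?_) G
  refine h (mk x) fun G' hG' => ?_
  obtain ⟨u, rfl⟩ := hx
  have key : ∀ y : Form, (y ∈ Finset.image Subtype.val u.left ∨
      y ∈ Finset.image Subtype.val u.right) → p y := by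
    rintro y (hy | hy) <;> obtain ⟨z, -, rfl⟩ := Finset.mem_image.1 hy <;> exact z.2
  rcases hG' with hG' | hG'
  · exact key G' (Or.inl ((left_mk _).subset hG'))
  · exact key G' (Or.inr ((right_mk _).subset hG'))

theorem wf_isOption : WellFounded IsOption :=
  ⟨induction fun G h => Acc.intro G h⟩

instance : WellFoundedRelation Form := ⟨IsOption, wf_isOption⟩

theorem isOption_of_mem_left {G' G : Form} (h : G' ∈ G.left) : IsOption G' G := Or.inl h

theorem isOption_of_mem_right {G' G : Form} (h : G' ∈ G.right) : IsOption G' G := Or.inr h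

/-- `G` is Left end-like: Left has no options, or there is a Left tombstone. -/
def LeftEndLike (G : Form) : Prop := G.left = ∅ ∨ G.LeftTomb

/-- `G` is Right end-like: Right has no options, or there is a Right tombstone. -/
def RightEndLike (G : Form) : Prop := G.right = ∅ ∨ G.RightTomb

/-- The zero form `{· | ·}`, without tombstones. -/
instance : Zero Form := ⟨mk ⟨∅, ∅, False, False⟩⟩

/-- The form `{l | r}`, without tombstones. -/
def ofSets (l r : Finset Form) : Form := mk ⟨l, r, False, False⟩

/-! ### Conjugates and disjunctive sums -/

/-- The conjugate: the roles of Left and Right are swapped in every subposition. -/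
def conj (G : Form) : Form :=
  mk ⟨G.right.attach.image fun G' => conj G'.1, G.left.attach.image fun G' => conj G'.1,
    G.RightTomb, G.LeftTomb⟩
termination_by G
decreasing_by
  · exact Or.inr G'.2
  · exact Or.inl G'.2

/-- The disjunctive sum: a move is a move in exactly one component. The sum has a Left tombstone
when both components are Left end-like and at least one has a Left tombstone (similarly for
Right). -/
def add (G H : Form) : Form :=
  mk ⟨(G.left.attach.image fun G' => add G'.1 H) ∪ (H.left.attach.image fun H' => add G H'.1),
    (G.right.attach.image fun G' => add G'.1 H) ∪ (H.right.attach.image fun H' => add G H'.1),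
    (G.LeftEndLike ∧ H.LeftEndLike) ∧ (G.LeftTomb ∨ H.LeftTomb),
    (G.RightEndLike ∧ H.RightEndLike) ∧ (G.RightTomb ∨ H.RightTomb)⟩
termination_by (G, H)
decreasing_by
  · exact Prod.Lex.left _ _ (isOption_of_mem_left G'.2)
  · exact Prod.Lex.right _ (isOption_of_mem_left H'.2)
  · exact Prod.Lex.left _ _ (isOption_of_mem_right G'.2)
  · exact Prod.Lex.right _ (isOption_of_mem_right H'.2)

instance : Add Form := ⟨add⟩

/-! ### Misère outcomes -/

mutual

/-- Left, moving first, wins `G` under misère play: she wins at once when `G` is Left end-like,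
and otherwise needs a move after which Right, moving first, does not win. -/
def LeftWinsFirst (G : Form) : Prop :=
  G.LeftEndLike ∨ ∃ G' : {x // x ∈ G.left}, ¬ RightWinsFirst G'.1
termination_by G
decreasing_by exact isOption_of_mem_left G'.2

/-- Right, moving first, wins `G` under misère play. -/
def RightWinsFirst (G : Form) : Prop :=
  G.RightEndLike ∨ ∃ G' : {x // x ∈ G.right}, ¬ LeftWinsFirst G'.1
termination_by G
decreasing_by exact isOption_of_mem_right G'.2

end

end Form

/-- The four outcomes: Left wins, the next player wins, the previous (second) player wins,
Right wins. -/
inductive Outcome : Type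
  | L
  | N
  | P
  | R

/-- The partial order of outcomes: `R` is least, `L` is greatest, and `N`, `P` are incomparable. -/
instance : LE Outcome := ⟨fun a b => a = b ∨ a = Outcome.R ∨ b = Outcome.L⟩

namespace Form

/-- The misère outcome of a form. -/
def outcome (G : Form) : Outcome :=
  if G.LeftWinsFirst then
    (if G.RightWinsFirst then Outcome.N else Outcome.L)
  else
    (if G.RightWinsFirst then Outcome.R else Outcome.P)

/-- `G ≥ H` modulo the set of games `A`. -/
def GeMod (A : Set Form) (G H : Form) : Prop :=
  ∀ X ∈ A, outcome (H + X) ≤ outcome (G + X)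

/-- `G ≡ H` modulo the set of games `A`. -/
def EqMod (A : Set Form) (G H : Form) : Prop := GeMod A G H ∧ GeMod A H G

/-- `G'` is a subposition of `G`: it is reached from `G` by a possibly empty, not necessarily
alternating, sequence of moves. -/
def Subposition (G' G : Form) : Prop := Relation.ReflTransGen IsOption G' G

/-- `G` is (strictly) 𝒫-free: no subposition has outcome 𝒫. -/
def PFree (G : Form) : Prop := ∀ G', Subposition G' G → outcome G' ≠ Outcome.P

end Form

open Form

/-- The set of strictly 𝒫-free elements of `A`. -/
def PF (A : Set Form) : Set Form := {G | G ∈ A ∧ PFree G}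

/-- The set of elements of `A` that are 𝒫-free modulo `S`, i.e. equivalent modulo `S` to a
strictly 𝒫-free form in `S`. -/
def PFMod (A S : Set Form) : Set Form := {G | G ∈ A ∧ ∃ H ∈ S, PFree H ∧ EqMod S G H}

/-! ### Sets of games -/

/-- `A` is closed under disjunctive sums. -/
def AddClosed (A : Set Form) : Prop := ∀ G ∈ A, ∀ H ∈ A, G + H ∈ A

/-- `A` is closed under conjugation. -/
def ConjClosed (A : Set Form) : Prop := ∀ G ∈ A, conj G ∈ A

/-- A monoid of games: an additively closed set of games with an element that is an identity
modulo the set. (The strict form `0` need not be an element.) -/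
structure IsMonoidOfGames (A : Set Form) : Prop where
  add_mem : AddClosed A
  exists_identity : ∃ E ∈ A, ∀ X ∈ A, EqMod A (E + X) X

/-- A universe: a nonempty set of games that is additively closed, hereditary, conjugate-closed,
and contains `{l | r}` for all nonempty finite subsets `l` and `r`. -/
structure IsUniverse (U : Set Form) : Prop where
  nonempty : U.Nonempty
  add_mem : AddClosed U
  hereditary : ∀ G ∈ U, ∀ G', IsOption G' G → G' ∈ U
  conj_mem : ConjClosed U
  ofSets_mem : ∀ l r : Finset Form, l.Nonempty → r.Nonempty → (∀ G ∈ l, G ∈ U) →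
    (∀ G ∈ r, G ∈ U) → ofSets l r ∈ U

/-- The `A`-invertible elements of `A`. -/
def Invertibles (A : Set Form) : Set Form := {G | G ∈ A ∧ ∃ H ∈ A, EqMod A (G + H) 0}

/-- The conjugate `A`-invertible elements of `A`. -/
def ConjInvertibles (A : Set Form) : Set Form := {G | G ∈ A ∧ conj G ∈ A ∧ EqMod A (G + conj G) 0}

/-- `P ≤ Q` modulo `A`: the set `P` is contained in `Q`, and the classes of the elements of `P`
modulo `A` form a group under addition with identity the class of `0`. -/
structure IsSubgroupMod (A P Q : Set Form) : Prop where
  subset : P ⊆ Q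
  add : ∀ G ∈ P, ∀ H ∈ P, ∃ K ∈ P, EqMod A K (G + H)
  zero : ∃ E ∈ P, EqMod A E 0
  neg : ∀ G ∈ P, ∃ H ∈ P, EqMod A (G + H) 0

end Misere

end

open Misere

-- The crux is that, in a universe `U`, every 𝒫-free form has its own conjugate as inverse. The
-- subpositions of a 𝒫-free form are 𝒫-free, hence invertible by hypothesis, so well-founded
-- induction reduces this to `add_conj_eqMod_zero`: an invertible `G` is conjugate invertible once
-- all its proper subpositions are.
--
-- That step rests on `GeMod.exists_left_of_mem_right`: if `J + G ≥ 0`, every Right move from it has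
-- a Left reply that is again `≥ 0`. Read option by option, this yields `J ≥ conj G`, except for the
-- end-like provisos of `geMod_of_options`. If `G` were a counterexample with inverse `H`, the
-- failing provisos would place `H` between a Left end-like and a Right end-like form. Then `G` with
-- both tombstones added, for which the provisos do hold, is equivalent to `conj H`. This forces `H
-- + conj H ≡ 0`, and uniqueness of inverses gives `H ≡ conj G`, a contradiction.
--
-- Closure of `PF U` under sums is easier: a subposition of `G + H` is a sum of subpositions,
-- equivalent to some 𝒫-free form, and equivalence preserves outcomes. Both facts pass to a
-- conjugate-closed `A ⊆ U`, since equivalence modulo `U` implies equivalence modulo `A`. Replacing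
-- forms by 𝒫-free representatives then handles `PFMod A A`.

namespace Misere

open scoped Classical

namespace Form

/-! ### Sums and conjugates -/

theorem mem_left_add {G H K : Form} : K ∈ (G + H).left ↔
    (∃ G' ∈ G.left, G' + H = K) ∨ ∃ H' ∈ H.left, G + H' = K := by
  change K ∈ (add G H).left ↔ (∃ G' ∈ G.left, add G' H = K) ∨ ∃ H' ∈ H.left, add G H' = K
  rw [add]
  simp

theorem mem_right_add {G H K : Form} : K ∈ (G + H).right ↔
    (∃ G' ∈ G.right, G' + H = K) ∨ ∃ H' ∈ H.right, G + H' = K := by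
  change K ∈ (add G H).right ↔ (∃ G' ∈ G.right, add G' H = K) ∨ ∃ H' ∈ H.right, add G H' = K
  rw [add]
  simp

theorem leftTomb_add {G H : Form} : (G + H).LeftTomb ↔
    (G.LeftEndLike ∧ H.LeftEndLike) ∧ (G.LeftTomb ∨ H.LeftTomb) := by
  change (add G H).LeftTomb ↔ _
  rw [add]
  simp

theorem rightTomb_add {G H : Form} : (G + H).RightTomb ↔
    (G.RightEndLike ∧ H.RightEndLike) ∧ (G.RightTomb ∨ H.RightTomb) := by
  change (add G H).RightTomb ↔ _
  rw [add]
  simp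

theorem left_add_eq_empty {G H : Form} : (G + H).left = ∅ ↔ G.left = ∅ ∧ H.left = ∅ := by
  simp only [Finset.eq_empty_iff_forall_notMem, mem_left_add]
  grind

theorem right_add_eq_empty {G H : Form} : (G + H).right = ∅ ↔ G.right = ∅ ∧ H.right = ∅ := by
  simp only [Finset.eq_empty_iff_forall_notMem, mem_right_add]
  grind

theorem leftEndLike_add {G H : Form} :
    (G + H).LeftEndLike ↔ G.LeftEndLike ∧ H.LeftEndLike := by
  simp only [LeftEndLike, leftTomb_add, left_add_eq_empty]
  tauto

theorem rightEndLike_add {G H : Form} :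
    (G + H).RightEndLike ↔ G.RightEndLike ∧ H.RightEndLike := by
  simp only [RightEndLike, rightTomb_add, right_add_eq_empty]
  tauto

theorem mem_left_conj {G K : Form} : K ∈ (conj G).left ↔ ∃ G' ∈ G.right, conj G' = K := by
  rw [conj]
  simp

theorem mem_right_conj {G K : Form} : K ∈ (conj G).right ↔ ∃ G' ∈ G.left, conj G' = K := by
  rw [conj]
  simp

theorem conj_mem_left_conj {G G' : Form} (h : G' ∈ G.right) : conj G' ∈ (conj G).left :=
  mem_left_conj.2 ⟨G', h, rfl⟩

theorem conj_mem_right_conj {G G' : Form} (h : G' ∈ G.left) : conj G' ∈ (conj G).right :=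
  mem_right_conj.2 ⟨G', h, rfl⟩

@[simp] theorem leftTomb_conj {G : Form} : (conj G).LeftTomb ↔ G.RightTomb := by
  rw [conj]
  simp

@[simp] theorem rightTomb_conj {G : Form} : (conj G).RightTomb ↔ G.LeftTomb := by
  rw [conj]
  simp

@[simp] theorem leftEndLike_conj {G : Form} : (conj G).LeftEndLike ↔ G.RightEndLike := by
  simp only [LeftEndLike, RightEndLike, leftTomb_conj, Finset.eq_empty_iff_forall_notMem,
    mem_left_conj]
  grind

@[simp] theorem rightEndLike_conj {G : Form} : (conj G).RightEndLike ↔ G.LeftEndLike := by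
  simp only [LeftEndLike, RightEndLike, rightTomb_conj, Finset.eq_empty_iff_forall_notMem,
    mem_right_conj]
  grind

@[simp] theorem conj_conj (G : Form) : conj (conj G) = G := by
  induction G using Form.induction with
  | h G ih =>
    refine Form.ext (Finset.ext fun K => ?_) (Finset.ext fun K => ?_) (by simp) (by simp)
    · rw [mem_left_conj]
      constructor
      · rintro ⟨G', h, rfl⟩
        obtain ⟨G'', h'', rfl⟩ := mem_right_conj.1 h
        rwa [ih _ (Or.inl h'')]
      · exact fun h => ⟨conj K, conj_mem_right_conj h, ih _ (Or.inl h)⟩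
    · rw [mem_right_conj]
      constructor
      · rintro ⟨G', h, rfl⟩
        obtain ⟨G'', h'', rfl⟩ := mem_left_conj.1 h
        rwa [ih _ (Or.inr h'')]
      · exact fun h => ⟨conj K, conj_mem_left_conj h, ih _ (Or.inr h)⟩

protected theorem add_comm (G H : Form) : G + H = H + G := by
  induction G using Form.induction generalizing H with
  | h G ihG =>
    induction H using Form.induction with
    | h H ihH =>
      refine Form.ext (Finset.ext fun K => ?_) (Finset.ext fun K => ?_) ?_ ?_
      · rw [mem_left_add, mem_left_add, or_comm]
        exact or_congr
          (exists_congr fun H' => and_congr_right fun h => by rw [ihH _ (Or.inl h)])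
          (exists_congr fun G' => and_congr_right fun h => by rw [ihG _ (Or.inl h)])
      · rw [mem_right_add, mem_right_add, or_comm]
        exact or_congr
          (exists_congr fun H' => and_congr_right fun h => by rw [ihH _ (Or.inr h)])
          (exists_congr fun G' => and_congr_right fun h => by rw [ihG _ (Or.inr h)])
      · rw [leftTomb_add, leftTomb_add]; tauto
      · rw [rightTomb_add, rightTomb_add]; tauto

theorem conj_add (G H : Form) : conj (G + H) = conj G + conj H := by
  induction G using Form.induction generalizing H with
  | h G ihG =>
    induction H using Form.induction with
    | h H ihH =>
      refine Form.ext (Finset.ext fun K => ?_) (Finset.ext fun K => ?_) ?_ ?_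
      · simp only [mem_left_conj, mem_right_add, mem_left_add]
        constructor
        · rintro ⟨_, ⟨G', h, rfl⟩ | ⟨H', h, rfl⟩, rfl⟩
          · exact Or.inl ⟨_, ⟨G', h, rfl⟩, (ihG _ (Or.inr h) H).symm⟩
          · exact Or.inr ⟨_, ⟨H', h, rfl⟩, (ihH _ (Or.inr h)).symm⟩
        · rintro (⟨_, ⟨G', h, rfl⟩, rfl⟩ | ⟨_, ⟨H', h, rfl⟩, rfl⟩)
          · exact ⟨_, Or.inl ⟨G', h, rfl⟩, ihG _ (Or.inr h) H⟩
          · exact ⟨_, Or.inr ⟨H', h, rfl⟩, ihH _ (Or.inr h)⟩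
      · simp only [mem_right_conj, mem_right_add, mem_left_add]
        constructor
        · rintro ⟨_, ⟨G', h, rfl⟩ | ⟨H', h, rfl⟩, rfl⟩
          · exact Or.inl ⟨_, ⟨G', h, rfl⟩, (ihG _ (Or.inl h) H).symm⟩
          · exact Or.inr ⟨_, ⟨H', h, rfl⟩, (ihH _ (Or.inl h)).symm⟩
        · rintro (⟨_, ⟨G', h, rfl⟩, rfl⟩ | ⟨_, ⟨H', h, rfl⟩, rfl⟩)
          · exact ⟨_, Or.inl ⟨G', h, rfl⟩, ihG _ (Or.inl h) H⟩
          · exact ⟨_, Or.inr ⟨H', h, rfl⟩, ihH _ (Or.inl h)⟩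
      · simp [leftTomb_add, rightTomb_add]
      · simp [leftTomb_add, rightTomb_add]

protected theorem add_assoc (G H K : Form) : G + H + K = G + (H + K) := by
  induction G using Form.induction generalizing H K with
  | h G ihG =>
    induction H using Form.induction generalizing K with
    | h H ihH =>
      induction K using Form.induction with
      | h K ihK =>
        refine Form.ext (Finset.ext fun M => ?_) (Finset.ext fun M => ?_) ?_ ?_
        · simp only [mem_left_add]
          constructor
          · rintro (⟨_, ⟨G', h, rfl⟩ | ⟨H', h, rfl⟩, rfl⟩ | ⟨K', h, rfl⟩)
            · exact Or.inl ⟨G', h, (ihG _ (Or.inl h) _ _).symm⟩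
            · exact Or.inr ⟨_, Or.inl ⟨H', h, rfl⟩, (ihH _ (Or.inl h) _).symm⟩
            · exact Or.inr ⟨_, Or.inr ⟨K', h, rfl⟩, (ihK _ (Or.inl h)).symm⟩
          · rintro (⟨G', h, rfl⟩ | ⟨_, ⟨H', h, rfl⟩ | ⟨K', h, rfl⟩, rfl⟩)
            · exact Or.inl ⟨_, Or.inl ⟨G', h, rfl⟩, ihG _ (Or.inl h) _ _⟩
            · exact Or.inl ⟨_, Or.inr ⟨H', h, rfl⟩, ihH _ (Or.inl h) _⟩
            · exact Or.inr ⟨K', h, ihK _ (Or.inl h)⟩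
        · simp only [mem_right_add]
          constructor
          · rintro (⟨_, ⟨G', h, rfl⟩ | ⟨H', h, rfl⟩, rfl⟩ | ⟨K', h, rfl⟩)
            · exact Or.inl ⟨G', h, (ihG _ (Or.inr h) _ _).symm⟩
            · exact Or.inr ⟨_, Or.inl ⟨H', h, rfl⟩, (ihH _ (Or.inr h) _).symm⟩
            · exact Or.inr ⟨_, Or.inr ⟨K', h, rfl⟩, (ihK _ (Or.inr h)).symm⟩
          · rintro (⟨G', h, rfl⟩ | ⟨_, ⟨H', h, rfl⟩ | ⟨K', h, rfl⟩, rfl⟩)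
            · exact Or.inl ⟨_, Or.inl ⟨G', h, rfl⟩, ihG _ (Or.inr h) _ _⟩
            · exact Or.inl ⟨_, Or.inr ⟨H', h, rfl⟩, ihH _ (Or.inr h) _⟩
            · exact Or.inr ⟨K', h, ihK _ (Or.inr h)⟩
        · simp only [leftTomb_add, leftEndLike_add]
          tauto
        · simp only [rightTomb_add, rightEndLike_add]
          tauto

@[simp] theorem left_zero : (0 : Form).left = ∅ := left_mk _

@[simp] theorem right_zero : (0 : Form).right = ∅ := right_mk _

@[simp] theorem leftTomb_zero : ¬ (0 : Form).LeftTomb := by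
  change ¬ (mk _).LeftTomb
  simp

@[simp] theorem rightTomb_zero : ¬ (0 : Form).RightTomb := by
  change ¬ (mk _).RightTomb
  simp

protected theorem zero_add (G : Form) : 0 + G = G := by
  induction G using Form.induction with
  | h G ih =>
    refine Form.ext (Finset.ext fun K => ?_) (Finset.ext fun K => ?_) ?_ ?_
    · rw [mem_left_add]
      constructor
      · rintro (⟨G', h, -⟩ | ⟨G', h, rfl⟩)
        · simp at h
        · rwa [ih _ (Or.inl h)]
      · exact fun h => Or.inr ⟨K, h, ih _ (Or.inl h)⟩
    · rw [mem_right_add]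
      constructor
      · rintro (⟨G', h, -⟩ | ⟨G', h, rfl⟩)
        · simp at h
        · rwa [ih _ (Or.inr h)]
      · exact fun h => Or.inr ⟨K, h, ih _ (Or.inr h)⟩
    · simp [leftTomb_add, LeftEndLike]; tauto
    · simp [rightTomb_add, RightEndLike]; tauto

noncomputable instance : AddCommMonoid Form where
  add_assoc := Form.add_assoc
  zero_add := Form.zero_add
  add_zero G := by rw [Form.add_comm, Form.zero_add]
  add_comm := Form.add_comm
  nsmul := nsmulRec

@[simp] theorem conj_zero : conj 0 = 0 :=
  Form.ext (Finset.ext fun K => by simp [mem_left_conj]) (Finset.ext fun K => by simp [mem_right_conj])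
    (by simp) (by simp)

@[simp] theorem left_ofSets (l r : Finset Form) : (ofSets l r).left = l := left_mk _

@[simp] theorem right_ofSets (l r : Finset Form) : (ofSets l r).right = r := right_mk _

theorem not_leftEndLike_ofSets {l r : Finset Form} (h : l.Nonempty) :
    ¬ (ofSets l r).LeftEndLike := by
  rw [LeftEndLike, left_ofSets, ofSets, leftTomb_mk]
  simpa using h.ne_empty

theorem not_rightEndLike_ofSets {l r : Finset Form} (h : r.Nonempty) :
    ¬ (ofSets l r).RightEndLike := by
  rw [RightEndLike, right_ofSets, ofSets, rightTomb_mk]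
  simpa using h.ne_empty

/-! ### Outcomes -/

theorem leftWinsFirst_iff {G : Form} :
    G.LeftWinsFirst ↔ G.LeftEndLike ∨ ∃ G' ∈ G.left, ¬ G'.RightWinsFirst := by
  rw [LeftWinsFirst]
  simp

theorem rightWinsFirst_iff {G : Form} :
    G.RightWinsFirst ↔ G.RightEndLike ∨ ∃ G' ∈ G.right, ¬ G'.LeftWinsFirst := by
  rw [RightWinsFirst]
  simp

theorem LeftEndLike.leftWinsFirst {G : Form} (h : G.LeftEndLike) : G.LeftWinsFirst :=
  leftWinsFirst_iff.2 (Or.inl h)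

theorem RightEndLike.rightWinsFirst {G : Form} (h : G.RightEndLike) : G.RightWinsFirst :=
  rightWinsFirst_iff.2 (Or.inl h)

theorem winsFirst_conj (G : Form) :
    ((conj G).LeftWinsFirst ↔ G.RightWinsFirst) ∧ ((conj G).RightWinsFirst ↔ G.LeftWinsFirst) := by
  induction G using Form.induction with
  | h G ih =>
    constructor
    · rw [leftWinsFirst_iff, rightWinsFirst_iff, leftEndLike_conj]
      refine or_congr Iff.rfl ⟨?_, ?_⟩
      · rintro ⟨_, h, h'⟩
        obtain ⟨G', hG, rfl⟩ := mem_left_conj.1 h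
        exact ⟨G', hG, fun hn => h' ((ih _ (Or.inr hG)).2.2 hn)⟩
      · rintro ⟨G', hG, h'⟩
        exact ⟨_, conj_mem_left_conj hG, fun hn => h' ((ih _ (Or.inr hG)).2.1 hn)⟩
    · rw [leftWinsFirst_iff, rightWinsFirst_iff, rightEndLike_conj]
      refine or_congr Iff.rfl ⟨?_, ?_⟩
      · rintro ⟨_, h, h'⟩
        obtain ⟨G', hG, rfl⟩ := mem_right_conj.1 h
        exact ⟨G', hG, fun hn => h' ((ih _ (Or.inl hG)).1.2 hn)⟩
      · rintro ⟨G', hG, h'⟩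
        exact ⟨_, conj_mem_right_conj hG, fun hn => h' ((ih _ (Or.inl hG)).1.1 hn)⟩

@[simp] theorem leftWinsFirst_conj {G : Form} : (conj G).LeftWinsFirst ↔ G.RightWinsFirst :=
  (winsFirst_conj G).1

@[simp] theorem rightWinsFirst_conj {G : Form} : (conj G).RightWinsFirst ↔ G.LeftWinsFirst :=
  (winsFirst_conj G).2

theorem outcome_le_iff {G H : Form} : outcome G ≤ outcome H ↔
    (G.LeftWinsFirst → H.LeftWinsFirst) ∧ (H.RightWinsFirst → G.RightWinsFirst) := by
  change (_ = _ ∨ _ = _ ∨ _ = _) ↔ _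
  unfold outcome
  by_cases h1 : G.LeftWinsFirst <;> by_cases h2 : G.RightWinsFirst <;>
    by_cases h3 : H.LeftWinsFirst <;> by_cases h4 : H.RightWinsFirst <;>
    simp [h1, h2, h3, h4]

theorem outcome_eq_P_iff {G : Form} :
    outcome G = Outcome.P ↔ ¬ G.LeftWinsFirst ∧ ¬ G.RightWinsFirst := by
  unfold outcome
  by_cases h1 : G.LeftWinsFirst <;> by_cases h2 : G.RightWinsFirst <;> simp [h1, h2]

/-- A form without options may carry tombstones, but these never change who wins a sum. Such a form
can stand in for `0`, which a universe need not contain. -/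
theorem winsFirst_add_of_no_options {E : Form} (hl : E.left = ∅) (hr : E.right = ∅) (X : Form) :
    ((E + X).LeftWinsFirst ↔ X.LeftWinsFirst) ∧ ((E + X).RightWinsFirst ↔ X.RightWinsFirst) := by
  have hL : E.LeftEndLike := Or.inl hl
  have hR : E.RightEndLike := Or.inl hr
  induction X using Form.induction with
  | h X ih =>
    constructor
    · rw [leftWinsFirst_iff, leftWinsFirst_iff, leftEndLike_add]
      simp only [mem_left_add, hl, Finset.notMem_empty, false_and, exists_false, false_or]
      refine or_congr (and_iff_right hL) ⟨?_, ?_⟩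
      · rintro ⟨_, ⟨X', h, rfl⟩, h'⟩
        exact ⟨X', h, fun hn => h' ((ih _ (Or.inl h)).2.2 hn)⟩
      · rintro ⟨X', h, h'⟩
        exact ⟨_, ⟨X', h, rfl⟩, fun hn => h' ((ih _ (Or.inl h)).2.1 hn)⟩
    · rw [rightWinsFirst_iff, rightWinsFirst_iff, rightEndLike_add]
      simp only [mem_right_add, hr, Finset.notMem_empty, false_and, exists_false, false_or]
      refine or_congr (and_iff_right hR) ⟨?_, ?_⟩
      · rintro ⟨_, ⟨X', h, rfl⟩, h'⟩
        exact ⟨X', h, fun hn => h' ((ih _ (Or.inr h)).1.2 hn)⟩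
      · rintro ⟨X', h, h'⟩
        exact ⟨_, ⟨X', h, rfl⟩, fun hn => h' ((ih _ (Or.inr h)).1.1 hn)⟩

/-! ### Order modulo a set -/

variable {A U : Set Form} {G H K : Form}

theorem geMod_iff : GeMod A G H ↔ ∀ X ∈ A, ((H + X).LeftWinsFirst → (G + X).LeftWinsFirst) ∧
    ((G + X).RightWinsFirst → (H + X).RightWinsFirst) :=
  forall₂_congr fun _ _ => outcome_le_iff

theorem GeMod.left (h : GeMod A G H) {X : Form} (hX : X ∈ A) (hw : (H + X).LeftWinsFirst) :
    (G + X).LeftWinsFirst :=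
  (geMod_iff.1 h X hX).1 hw

theorem GeMod.right (h : GeMod A G H) {X : Form} (hX : X ∈ A) (hw : (G + X).RightWinsFirst) :
    (H + X).RightWinsFirst :=
  (geMod_iff.1 h X hX).2 hw

theorem GeMod.refl (A : Set Form) (G : Form) : GeMod A G G :=
  geMod_iff.2 fun _ _ => ⟨id, id⟩

theorem GeMod.trans (h₁ : GeMod A G H) (h₂ : GeMod A H K) : GeMod A G K :=
  geMod_iff.2 fun _ hX => ⟨fun h => h₁.left hX (h₂.left hX h), fun h => h₂.right hX (h₁.right hX h)⟩

theorem GeMod.mono {B : Set Form} (hAB : A ⊆ B) (h : GeMod B G H) : GeMod A G H :=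
  fun X hX => h X (hAB hX)

theorem GeMod.add_right (hA : AddClosed A) (h : GeMod A G H) (hK : K ∈ A) :
    GeMod A (G + K) (H + K) := fun X hX => by
  rw [add_assoc, add_assoc]
  exact h _ (hA _ hK _ hX)

theorem GeMod.conj (hA : ConjClosed A) (h : GeMod A G H) : GeMod A (conj H) (conj G) :=
  geMod_iff.2 fun X hX => by
    have e (F : Form) : Form.conj F + X = Form.conj (F + Form.conj X) := by
      rw [conj_add, conj_conj]
    rw [e, e]
    simp only [leftWinsFirst_conj, rightWinsFirst_conj]
    exact ⟨h.right (hA X hX), h.left (hA X hX)⟩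

theorem EqMod.refl (A : Set Form) (G : Form) : EqMod A G G := ⟨GeMod.refl A G, GeMod.refl A G⟩

theorem EqMod.symm (h : EqMod A G H) : EqMod A H G := ⟨h.2, h.1⟩

theorem EqMod.trans (h₁ : EqMod A G H) (h₂ : EqMod A H K) : EqMod A G K :=
  ⟨h₁.1.trans h₂.1, h₂.2.trans h₁.2⟩

theorem EqMod.mono {B : Set Form} (hAB : A ⊆ B) (h : EqMod B G H) : EqMod A G H :=
  ⟨h.1.mono hAB, h.2.mono hAB⟩

theorem EqMod.add_right (hA : AddClosed A) (h : EqMod A G H) (hK : K ∈ A) :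
    EqMod A (G + K) (H + K) := ⟨h.1.add_right hA hK, h.2.add_right hA hK⟩

theorem EqMod.conj (hA : ConjClosed A) (h : EqMod A G H) : EqMod A (conj G) (conj H) :=
  ⟨h.2.conj hA, h.1.conj hA⟩

theorem EqMod.add (hA : AddClosed A) {G' H' : Form} (h : EqMod A G H) (h' : EqMod A G' H')
    (hG' : G' ∈ A) (hH : H ∈ A) : EqMod A (G + G') (H + H') := by
  refine (h.add_right hA hG').trans ?_
  rw [add_comm H G', add_comm H H']
  exact h'.add_right hA hH

/-- The sum `G + conj G` is its own conjugate, and conjugation reverses the order, so one inequality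
with `0` yields the other. -/
theorem eqMod_zero_of_ge (hA : ConjClosed A) (h : GeMod A (G + Form.conj G) 0) :
    EqMod A (G + Form.conj G) 0 := by
  refine ⟨h, ?_⟩
  have := h.conj hA
  rwa [conj_add, conj_conj, conj_zero, add_comm] at this

theorem eqMod_zero_of_le (hA : ConjClosed A) (h : GeMod A 0 (G + Form.conj G)) :
    EqMod A (G + Form.conj G) 0 := by
  refine ⟨?_, h⟩
  have := h.conj hA
  rwa [conj_add, conj_conj, conj_zero, add_comm] at this

/-- Sufficient recursive condition for `G ≥ H` modulo a hereditary set. The forms `G` and `H` need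
not belong to the set. -/
theorem geMod_of_options (hU : ∀ G ∈ U, ∀ G', IsOption G' G → G' ∈ U)
    (hR : ∀ G' ∈ G.right, (∃ H' ∈ H.right, GeMod U G' H') ∨ ∃ G'' ∈ G'.left, GeMod U G'' H)
    (hL : ∀ H' ∈ H.left, (∃ G' ∈ G.left, GeMod U G' H') ∨ ∃ H'' ∈ H'.right, GeMod U G H'')
    (hLE : H.LeftEndLike → ∀ X ∈ U, X.LeftEndLike → (G + X).LeftWinsFirst)
    (hRE : G.RightEndLike → ∀ X ∈ U, X.RightEndLike → (H + X).RightWinsFirst) :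
    GeMod U G H := by
  rw [geMod_iff]
  intro X hX
  induction X using Form.induction with
  | h X ih =>
    constructor
    · intro h
      rcases leftWinsFirst_iff.1 h with he | ⟨_, hm, hn⟩
      · rw [leftEndLike_add] at he
        exact hLE he.1 X hX he.2
      rcases mem_left_add.1 hm with ⟨H', hH', rfl⟩ | ⟨X', hX', rfl⟩
      · rcases hL H' hH' with ⟨G', hG', hge⟩ | ⟨H'', hH'', hge⟩
        · exact leftWinsFirst_iff.2 (Or.inr ⟨_, mem_left_add.2 (Or.inl ⟨G', hG', rfl⟩),
            fun hn' => hn (hge.right hX hn')⟩)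
        -- Right moving first loses `H' + X`, so Left moving first wins after Right's move to `H'' +
        -- X`; this transfers along `G ≥ H''`.
        · refine hge.left hX (by_contra fun hn' => hn ?_)
          exact rightWinsFirst_iff.2 (Or.inr ⟨_, mem_right_add.2 (Or.inl ⟨H'', hH'', rfl⟩), hn'⟩)
      · exact leftWinsFirst_iff.2 (Or.inr ⟨_, mem_left_add.2 (Or.inr ⟨X', hX', rfl⟩),
          fun hn' => hn ((ih X' (Or.inl hX') (hU X hX X' (Or.inl hX'))).2 hn')⟩)
    · intro h
      rcases rightWinsFirst_iff.1 h with he | ⟨_, hm, hn⟩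
      · rw [rightEndLike_add] at he
        exact hRE he.1 X hX he.2
      rcases mem_right_add.1 hm with ⟨G', hG', rfl⟩ | ⟨X', hX', rfl⟩
      · rcases hR G' hG' with ⟨H', hH', hge⟩ | ⟨G'', hG'', hge⟩
        · exact rightWinsFirst_iff.2 (Or.inr ⟨_, mem_right_add.2 (Or.inl ⟨H', hH', rfl⟩),
            fun hn' => hn (hge.left hX hn')⟩)
        · refine hge.right hX (by_contra fun hn' => hn ?_)
          exact leftWinsFirst_iff.2 (Or.inr ⟨_, mem_left_add.2 (Or.inl ⟨G'', hG'', rfl⟩), hn'⟩)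
      · exact rightWinsFirst_iff.2 (Or.inr ⟨_, mem_right_add.2 (Or.inr ⟨X', hX', rfl⟩),
          fun hn' => hn ((ih X' (Or.inr hX') (hU X hX X' (Or.inr hX'))).1 hn')⟩)

/-! ### Comparison with zero in a universe -/

theorem exists_no_options (hU : IsUniverse U) : ∃ E ∈ U, E.left = ∅ ∧ E.right = ∅ := by
  obtain ⟨G, hG⟩ := hU.nonempty
  induction G using Form.induction with
  | h G ih =>
    by_cases h : ∃ G', IsOption G' G
    · obtain ⟨G', h⟩ := h
      exact ih G' h (hU.hereditary G hG G' h)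
    · refine ⟨G, hG, ?_, ?_⟩ <;> refine Finset.eq_empty_of_forall_notMem fun G' h' => h ⟨G', ?_⟩
      exacts [Or.inl h', Or.inr h']

/-- Recursively, `B = {t | E, b(Gᴸ)}`: the move to `Gᴸ + B` is answered by `b(Gᴸ)`, and after the
move to `G + t` Right wins by the choice of `t`. Including `E` only keeps the set of Right options
nonempty. -/
theorem exists_not_leftWinsFirst_add (hU : IsUniverse U) (hG : G ∈ U) :
    ∃ B ∈ U, ¬ (G + B).LeftWinsFirst := by
  obtain ⟨E, hE, hEl, hEr⟩ := exists_no_options hU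
  induction G using Form.induction with
  | h G ih =>
    have ih' : ∀ G' : {x // IsOption x G}, ∃ B ∈ U, ¬ (G'.1 + B).LeftWinsFirst :=
      fun G' => ih G' G'.2 (hU.hereditary G hG G' G'.2)
    choose b hbU hb using ih'
    obtain ⟨t, htU, ht⟩ : ∃ t ∈ U, (G + t).RightWinsFirst := by
      by_cases hR : G.right = ∅
      · exact ⟨E, hE, (rightEndLike_add.2 ⟨Or.inl hR, Or.inl hEr⟩).rightWinsFirst⟩
      · obtain ⟨G', hG'⟩ := Finset.nonempty_iff_ne_empty.2 hR
        exact ⟨_, hbU ⟨G', Or.inr hG'⟩, rightWinsFirst_iff.2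
          (Or.inr ⟨_, mem_right_add.2 (Or.inl ⟨G', hG', rfl⟩), hb ⟨G', Or.inr hG'⟩⟩)⟩
    let r : Finset Form := insert E (G.left.attach.image fun G' => b ⟨G'.1, Or.inl G'.2⟩)
    refine ⟨ofSets {t} r, hU.ofSets_mem _ _ (by simp) (by simp [r]) (by simpa using htU) ?_, ?_⟩
    · intro B hB
      simp only [r, Finset.mem_insert, Finset.mem_image, Finset.mem_attach, true_and] at hB
      rcases hB with rfl | ⟨G', rfl⟩
      exacts [hE, hbU _]
    · intro hw
      rcases leftWinsFirst_iff.1 hw with he | ⟨_, hm, hn⟩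
      · exact not_leftEndLike_ofSets (by simp) (leftEndLike_add.1 he).2
      rcases mem_left_add.1 hm with ⟨G', hG', rfl⟩ | ⟨B', hB', rfl⟩
      · refine hn (rightWinsFirst_iff.2 (Or.inr ⟨_, mem_right_add.2
          (Or.inr ⟨b ⟨G', Or.inl hG'⟩, ?_, rfl⟩), hb ⟨G', Or.inl hG'⟩⟩))
        rw [right_ofSets]
        exact Finset.mem_insert_of_mem (Finset.mem_image.2 ⟨⟨G', hG'⟩, Finset.mem_attach _ _, rfl⟩)
      · rw [left_ofSets, Finset.mem_singleton] at hB'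
        subst hB'
        exact hn ht

/-- A failure `X` seen with Right moving first becomes one seen with Left moving first in `Y = {X |
E, b(Gᴸ)}`: Left wins `Y` by moving to `X`, but in `G + Y` Right wins after the move to `G + X`, and
the moves in `G` are refuted by the `b(Gᴸ)`. -/
theorem exists_leftWinsFirst_of_not_ge_zero (hU : IsUniverse U) (hG : G ∈ U)
    (h : ¬ GeMod U G 0) : ∃ Y ∈ U, Y.LeftWinsFirst ∧ ¬ (G + Y).LeftWinsFirst := by
  obtain ⟨E, hE, hEl, hEr⟩ := exists_no_options hU
  rw [geMod_iff] at h
  push Not at h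
  obtain ⟨X, hX, h⟩ := h
  rw [zero_add] at h
  by_cases hl : X.LeftWinsFirst → (G + X).LeftWinsFirst
  · obtain ⟨hGX, hXw⟩ := h hl
    have : ∀ G' : {x // x ∈ G.left}, ∃ B ∈ U, ¬ (G'.1 + B).LeftWinsFirst := fun G' =>
      exists_not_leftWinsFirst_add hU (hU.hereditary G hG G' (Or.inl G'.2))
    choose b hbU hb using this
    let r : Finset Form := insert E (G.left.attach.image b)
    refine ⟨ofSets {X} r, hU.ofSets_mem _ _ (by simp) (by simp [r]) (by simpa using hX) ?_,
      leftWinsFirst_iff.2 (Or.inr ⟨X, by simp, hXw⟩), ?_⟩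
    · intro B hB
      simp only [r, Finset.mem_insert, Finset.mem_image, Finset.mem_attach, true_and] at hB
      rcases hB with rfl | ⟨G', rfl⟩
      exacts [hE, hbU _]
    · intro hw
      rcases leftWinsFirst_iff.1 hw with he | ⟨_, hm, hn⟩
      · exact not_leftEndLike_ofSets (by simp) (leftEndLike_add.1 he).2
      rcases mem_left_add.1 hm with ⟨G', hG', rfl⟩ | ⟨B', hB', rfl⟩
      · refine hn (rightWinsFirst_iff.2 (Or.inr ⟨_, mem_right_add.2
          (Or.inr ⟨b ⟨G', hG'⟩, ?_, rfl⟩), hb ⟨G', hG'⟩⟩))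
        rw [right_ofSets]
        exact Finset.mem_insert_of_mem (Finset.mem_image.2 ⟨⟨G', hG'⟩, Finset.mem_attach _ _, rfl⟩)
      · rw [left_ofSets, Finset.mem_singleton] at hB'
        subst hB'
        exact hn hGX
  · exact ⟨X, hX, Classical.not_imp.1 hl⟩

/-- If `G ≥ 0` modulo a universe, then every Right option of `G` has a Left option that is `≥ 0`. -/
theorem GeMod.exists_left_of_mem_right (hU : IsUniverse U) (hG : G ∈ U) (h : GeMod U G 0)
    {G' : Form} (hG' : G' ∈ G.right) : ∃ G'' ∈ G'.left, GeMod U G'' 0 := by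
  obtain ⟨E, hE, hEl, hEr⟩ := exists_no_options hU
  have hG'U := hU.hereditary G hG G' (Or.inr hG')
  by_contra hno
  have : ∀ G'' : {x // x ∈ G'.left}, ∃ Y ∈ U, Y.LeftWinsFirst ∧ ¬ (G''.1 + Y).LeftWinsFirst :=
    fun G'' => exists_leftWinsFirst_of_not_ge_zero hU
      (hU.hereditary G' hG'U G'' (Or.inl G''.2)) fun hge => hno ⟨G'', G''.2, hge⟩
  choose y hyU hyw hy using this
  obtain ⟨b, hbU, hb⟩ := exists_not_leftWinsFirst_add hU hG'U
  -- The test form is `T = {t | E, y(G'')}`. After Right moves to `G' + T`, each `G'' + T` is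
  -- answered by `y(G'')`, and `G' + t` by `b`. So Right wins `G + T` moving first, whereas in `T`
  -- alone every Right option is won by Left moving first.
  let t := ofSets {E} {b}
  have htU : t ∈ U := hU.ofSets_mem _ _ (by simp) (by simp) (by simpa using hE) (by simpa using hbU)
  have ht : (G' + t).RightWinsFirst := rightWinsFirst_iff.2
    (Or.inr ⟨_, mem_right_add.2 (Or.inr ⟨b, by simp [t], rfl⟩), hb⟩)
  let r : Finset Form := insert E (G'.left.attach.image y)
  have hr : ∀ B ∈ r, B ∈ U ∧ B.LeftWinsFirst := by
    intro B hB
    simp only [r, Finset.mem_insert, Finset.mem_image, Finset.mem_attach, true_and] at hB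
    rcases hB with rfl | ⟨G', rfl⟩
    exacts [⟨hE, LeftEndLike.leftWinsFirst (Or.inl hEl)⟩, ⟨hyU _, hyw _⟩]
  have hTU : ofSets {t} r ∈ U := hU.ofSets_mem _ _ (by simp) (by simp [r]) (by simpa using htU)
    fun B hB => (hr B hB).1
  have hGT : (G + ofSets {t} r).RightWinsFirst := by
    refine rightWinsFirst_iff.2 (Or.inr ⟨_, mem_right_add.2 (Or.inl ⟨G', hG', rfl⟩), fun hw => ?_⟩)
    rcases leftWinsFirst_iff.1 hw with he | ⟨_, hm, hn⟩
    · exact not_leftEndLike_ofSets (by simp) (leftEndLike_add.1 he).2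
    rcases mem_left_add.1 hm with ⟨G'', hG'', rfl⟩ | ⟨B', hB', rfl⟩
    · refine hn (rightWinsFirst_iff.2 (Or.inr ⟨_, mem_right_add.2
        (Or.inr ⟨y ⟨G'', hG''⟩, ?_, rfl⟩), hy ⟨G'', hG''⟩⟩))
      rw [right_ofSets]
      exact Finset.mem_insert_of_mem (Finset.mem_image.2 ⟨⟨G'', hG''⟩, Finset.mem_attach _ _, rfl⟩)
    · rw [left_ofSets, Finset.mem_singleton] at hB'
      subst hB'
      exact hn ht
  have hT := h.right hTU hGT
  rw [zero_add] at hT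
  rcases rightWinsFirst_iff.1 hT with he | ⟨B, hB, hn⟩
  · exact not_rightEndLike_ofSets (by simp [r]) he
  · rw [right_ofSets] at hB
    exact hn (hr B hB).2

/-! ### Inverses are conjugates -/

/-- `G` is Left strong: Left, moving first, wins `G + X` for every Left end-like `X`. -/
def LeftStrong (U : Set Form) (G : Form) : Prop :=
  ∀ X ∈ U, X.LeftEndLike → (G + X).LeftWinsFirst

/-- `G` is Right strong: Right, moving first, wins `G + X` for every Right end-like `X`. -/
def RightStrong (U : Set Form) (G : Form) : Prop :=
  ∀ X ∈ U, X.RightEndLike → (G + X).RightWinsFirst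

theorem LeftEndLike.leftStrong (h : G.LeftEndLike) : LeftStrong U G := fun _ _ hX =>
  (leftEndLike_add.2 ⟨h, hX⟩).leftWinsFirst

theorem RightEndLike.rightStrong (h : G.RightEndLike) : RightStrong U G := fun _ _ hX =>
  (rightEndLike_add.2 ⟨h, hX⟩).rightWinsFirst

theorem GeMod.leftStrong (h : GeMod U G H) (hH : LeftStrong U H) : LeftStrong U G :=
  fun X hX hXl => h.left hX (hH X hX hXl)

/-- Add `conj H` to `G + H ≥ 0` and cancel `H + conj H`. -/
theorem ge_conj_of_add_nonneg (hU : AddClosed U) (hG : G ∈ U) (hH : Form.conj H ∈ U)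
    (hgood : EqMod U (H + Form.conj H) 0) (h : GeMod U (G + H) 0) : GeMod U G (Form.conj H) := by
  have h₁ := h.add_right hU hH
  have h₂ := hgood.2.add_right hU hG
  rw [zero_add] at h₁ h₂
  refine h₂.trans ?_
  rwa [add_comm, ← add_assoc]

/-- `J + G ≥ 0` implies `J ≥ V` when `V` is the conjugate of `G` up to its own tombstones, the proper
subpositions of `G` are conjugate invertible, and the end-like forms satisfy the provisos. -/
theorem ge_of_add_nonneg_of_left_eq (hU : IsUniverse U) (hG : G ∈ U)
    (hgood : ∀ G', Relation.TransGen IsOption G' G → EqMod U (G' + conj G') 0) {V : Form}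
    (hVl : V.left = (conj G).left) (hVr : V.right = (conj G).right)
    (hL : V.LeftEndLike → ∀ J ∈ U, GeMod U (J + G) 0 → LeftStrong U J)
    (hR : ∀ J ∈ U, GeMod U (J + G) 0 → J.RightEndLike → RightStrong U V)
    {J : Form} (hJ : J ∈ U) (h : GeMod U (J + G) 0) : GeMod U J V := by
  have hmem : ∀ G', Relation.TransGen IsOption G' G → G' ∈ U := by
    intro G' h
    induction h using Relation.TransGen.head_induction_on with
    | single h => exact hU.hereditary _ hG _ h
    | head h _ ih => exact hU.hereditary _ ih _ h
  induction J using wf_isOption.transGen.induction with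
  | _ J ih =>
    refine geMod_of_options hU.hereditary ?_ ?_ (fun he => hL he J hJ h) (hR J hJ h)
    · intro J' hJ'
      have hJ'U := hU.hereditary J hJ J' (Or.inr hJ')
      obtain ⟨_, hm, hge⟩ := h.exists_left_of_mem_right hU (hU.add_mem _ hJ _ hG)
        (mem_right_add.2 (Or.inl ⟨J', hJ', rfl⟩))
      rcases mem_left_add.1 hm with ⟨J'', hJ'', rfl⟩ | ⟨G', hG', rfl⟩
      · exact Or.inr ⟨J'', hJ'', ih J'' (.head (Or.inl hJ'') (.single (Or.inr hJ')))
          (hU.hereditary _ hJ'U _ (Or.inl hJ'')) hge⟩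
      -- Left's good reply was in `G`: from `J' + G' ≥ 0`, cancelling the conjugate invertible `G'`
      -- gives `J' ≥ conj G'`, a Right option of `V`.
      · have hG'G : Relation.TransGen IsOption G' G := .single (Or.inl hG')
        exact Or.inl ⟨conj G', hVr ▸ conj_mem_right_conj hG', ge_conj_of_add_nonneg hU.add_mem hJ'U
          (hU.conj_mem _ (hmem _ hG'G)) (hgood _ hG'G) hge⟩
    · intro V' hV'
      rw [hVl] at hV'
      obtain ⟨G', hG', rfl⟩ := mem_left_conj.1 hV'
      have hG'G : Relation.TransGen IsOption G' G := .single (Or.inr hG')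
      obtain ⟨_, hm, hge⟩ := h.exists_left_of_mem_right hU (hU.add_mem _ hJ _ hG)
        (mem_right_add.2 (Or.inr ⟨G', hG', rfl⟩))
      rcases mem_left_add.1 hm with ⟨J', hJ', rfl⟩ | ⟨G'', hG'', rfl⟩
      · exact Or.inl ⟨J', hJ', ge_conj_of_add_nonneg hU.add_mem (hU.hereditary J hJ J' (Or.inl hJ'))
          (hU.conj_mem _ (hmem _ hG'G)) (hgood _ hG'G) hge⟩
      · have hG''G : Relation.TransGen IsOption G'' G := .head (Or.inl hG'') hG'G
        exact Or.inr ⟨conj G'', conj_mem_right_conj hG'', ge_conj_of_add_nonneg hU.add_mem hJ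
          (hU.conj_mem _ (hmem _ hG''G)) (hgood _ hG''G) hge⟩

/-- `J + G ≥ 0` implies `J + W ≥ 0` when `W` is `G` up to its own tombstones, provided that all such
sums `J + W` are Left strong. -/
theorem add_nonneg_of_left_eq (hU : IsUniverse U) (hG : G ∈ U) {W : Form}
    (hWl : W.left = G.left) (hWr : W.right = G.right)
    (hs : ∀ J ∈ U, GeMod U (J + G) 0 → LeftStrong U (J + W))
    {J : Form} (hJ : J ∈ U) (h : GeMod U (J + G) 0) : GeMod U (J + W) 0 := by
  induction J using wf_isOption.transGen.induction with
  | _ J ih =>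
    refine geMod_of_options hU.hereditary ?_ (by simp) (fun _ => hs J hJ h) ?_
    · intro K hK
      refine Or.inr ?_
      rcases mem_right_add.1 hK with ⟨J', hJ', rfl⟩ | ⟨G', hG', rfl⟩
      · obtain ⟨_, hm, hge⟩ := h.exists_left_of_mem_right hU (hU.add_mem _ hJ _ hG)
          (mem_right_add.2 (Or.inl ⟨J', hJ', rfl⟩))
        rcases mem_left_add.1 hm with ⟨J'', hJ'', rfl⟩ | ⟨G', hG', rfl⟩
        · exact ⟨J'' + W, mem_left_add.2 (Or.inl ⟨J'', hJ'', rfl⟩),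
            ih J'' (.head (Or.inl hJ'') (.single (Or.inr hJ')))
              (hU.hereditary _ (hU.hereditary J hJ J' (Or.inr hJ')) _ (Or.inl hJ'')) hge⟩
        -- Once a move is made in `W`, its added tombstones are gone and the sum is literally one
        -- arising from `J + G`.
        · exact ⟨J' + G', mem_left_add.2 (Or.inr ⟨G', hWl ▸ hG', rfl⟩), hge⟩
      · exact h.exists_left_of_mem_right hU (hU.add_mem _ hJ _ hG)
          (mem_right_add.2 (Or.inr ⟨G', hWr ▸ hG', rfl⟩))
    · intro _ X _ hX
      rw [zero_add]
      exact hX.rightWinsFirst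

/-- If `G` is not conjugate invertible although all its proper subpositions are, and `G` has an
inverse `H`, then `H` is bounded above by a Right end-like form, and `G` is not Left end-like. -/
theorem exists_rightEndLike_of_not_conj_inverse (hU : IsUniverse U) (hG : G ∈ U)
    (hgood : ∀ G', Relation.TransGen IsOption G' G → EqMod U (G' + conj G') 0)
    (hbad : ¬ EqMod U (G + conj G) 0) (hH : H ∈ U) (hGH : EqMod U (H + G) 0)
    (hnr : ¬ G.RightEndLike) :
    (∃ F ∈ U, GeMod U (F + G) 0 ∧ F.RightEndLike) ∧ ¬ G.LeftEndLike := by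
  -- If every such `F` satisfied the Right proviso, then `H ≥ conj G`, so `0 ≥ G + conj G`, which by
  -- self-conjugacy contradicts `hbad`.
  have key : ∃ F ∈ U, GeMod U (F + G) 0 ∧ F.RightEndLike ∧ ¬ RightStrong U (conj G) := by
    by_contra hno
    push Not at hno
    have hge : GeMod U H (conj G) := ge_of_add_nonneg_of_left_eq hU hG hgood rfl rfl
      (fun he => absurd (leftEndLike_conj.1 he) hnr) hno hH hGH.1
    have h₁ := hge.add_right hU.add_mem hG
    rw [add_comm (conj G)] at h₁
    exact hbad (eqMod_zero_of_le hU.conj_mem (hGH.2.trans h₁))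
  obtain ⟨F, hF, h₁, h₂, h₃⟩ := key
  exact ⟨⟨F, hF, h₁, h₂⟩, fun he => h₃ (rightEndLike_conj.2 he).rightStrong⟩

theorem IsOption.conj {G' : Form} (h : IsOption G' G) : IsOption (conj G') (conj G) :=
  h.elim (fun h => Or.inr (conj_mem_right_conj h)) fun h => Or.inl (conj_mem_left_conj h)

theorem transGen_isOption_of_conj {G' : Form} (h : Relation.TransGen IsOption G' (conj G)) :
    Relation.TransGen IsOption (conj G') G := by
  have := Relation.TransGen.lift Form.conj (fun _ _ => IsOption.conj) _ _ h
  simpa [Function.onFun] using this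

theorem conj_add_conj_conj_eqMod_zero (h : EqMod U (G + conj G) 0) :
    EqMod U (conj G + conj (conj G)) 0 := by
  rwa [conj_conj, add_comm]

/-- In a universe, an inverse of `G` is the conjugate of `G` as soon as this holds for all proper
subpositions of `G`. -/
theorem add_conj_eqMod_zero (hU : IsUniverse U) (hG : G ∈ U)
    (hgood : ∀ G', Relation.TransGen IsOption G' G → EqMod U (G' + conj G') 0)
    (hH : H ∈ U) (hHG : EqMod U (H + G) 0) : EqMod U (G + conj G) 0 := by
  by_contra hbad
  have hcG := hU.conj_mem G hG
  have hcH := hU.conj_mem H hH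
  have hgood' : ∀ G', Relation.TransGen IsOption G' (conj G) → EqMod U (G' + conj G') 0 := by
    intro G' h
    simpa using conj_add_conj_conj_eqMod_zero (hgood _ (transGen_isOption_of_conj h))
  have hbad' : ¬ EqMod U (conj G + conj (conj G)) 0 := fun h =>
    hbad (by simpa using conj_add_conj_conj_eqMod_zero h)
  have hHG' : EqMod U (conj H + conj G) 0 := by
    have := hHG.conj hU.conj_mem
    rwa [conj_add, conj_zero] at this
  have hr := exists_rightEndLike_of_not_conj_inverse hU hG hgood hbad hH hHG
  have hl := exists_rightEndLike_of_not_conj_inverse hU hcG hgood' hbad' hcH hHG'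
  rw [rightEndLike_conj, leftEndLike_conj] at hl
  -- By `hr` and `hl`, `G` is end-like for both players or for neither. If for both, the mirror
  -- strategy already shows `G + conj G ≥ 0`.
  have hends : ¬ G.LeftEndLike ∧ ¬ G.RightEndLike := by
    by_contra hno
    by_cases h1 : G.LeftEndLike
    · by_cases h2 : G.RightEndLike
      · refine hbad (eqMod_zero_of_ge hU.conj_mem (geMod_of_options hU.hereditary ?_ (by simp)
          (fun _ => (leftEndLike_add.2 ⟨h1, leftEndLike_conj.2 h2⟩).leftStrong) ?_))
        · intro K hK
          refine Or.inr ?_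
          rcases mem_right_add.1 hK with ⟨G', hG', rfl⟩ | ⟨_, hG₁, rfl⟩
          · exact ⟨_, mem_left_add.2 (Or.inr ⟨_, conj_mem_left_conj hG', rfl⟩),
              (hgood G' (.single (Or.inr hG'))).1⟩
          · obtain ⟨G', hG', rfl⟩ := mem_right_conj.1 hG₁
            exact ⟨_, mem_left_add.2 (Or.inl ⟨_, hG', rfl⟩), (hgood G' (.single (Or.inl hG'))).1⟩
        · intro _ X _ hX
          rw [zero_add]
          exact hX.rightWinsFirst
      · exact (hr h2).2 h1
    · exact hno ⟨h1, fun h2 => (hl h1).2 h2⟩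
  obtain ⟨F, hF, hFG, hFe⟩ := (hr hends.2).1
  obtain ⟨E, hE, hEG, hEe⟩ := (hl hends.1).1
  -- anything that dominates an inverse of `G` dominates any `K` with `K + G ≤ 0`
  have dom : ∀ {G H J K : Form}, G ∈ U → H ∈ U → J ∈ U → K ∈ U → EqMod U (H + G) 0 →
      GeMod U (J + G) 0 → GeMod U 0 (K + G) → GeMod U J K := by
    intro G H J K hG hH hJ hK hHG hJG hKG
    have h₁ := (hJG.trans hKG).add_right hU.add_mem hH
    have h₂ := hHG.2.add_right hU.add_mem hJ
    have h₃ := hHG.1.add_right hU.add_mem hK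
    rw [zero_add] at h₂ h₃
    refine h₂.trans (GeMod.trans ?_ h₃)
    rwa [add_comm (H + G) J, add_comm H G, ← add_assoc, add_comm (G + H) K, ← add_assoc]
  have conj_le : ∀ {J G : Form}, GeMod U (J + G) 0 → GeMod U 0 (conj J + conj G) := by
    intro J G h
    have := h.conj hU.conj_mem
    rwa [conj_add, conj_zero] at this
  -- Hence `conj E ≤ H ≤ F`, with `conj E` Left end-like and `F` Right end-like.
  have hEG' : GeMod U 0 (conj E + G) := by simpa using conj_le hEG
  have strong : ∀ J ∈ U, GeMod U (J + G) 0 → LeftStrong U J := fun J hJ hJG =>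
    (dom hG hH hJ (hU.conj_mem E hE) hHG hJG hEG').leftStrong
      (LeftEndLike.leftStrong (leftEndLike_conj.2 hEe))
  have strong' : ∀ J ∈ U, GeMod U (J + conj G) 0 → LeftStrong U J := fun J hJ hJG =>
    (dom hcG hcH hJ (hU.conj_mem F hF) hHG' hJG (conj_le hFG)).leftStrong
      (LeftEndLike.leftStrong (leftEndLike_conj.2 hFe))
  -- `W` is `G` with both tombstones; it is equivalent to the conjugate of `H`
  let W : Form := mk ⟨G.left, G.right, True, True⟩
  have hWL : W.LeftEndLike := Or.inr (by simp [W])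
  have hWR : W.RightEndLike := Or.inr (by simp [W])
  have hWl : W.left = G.left := left_mk _
  have hWr : W.right = G.right := right_mk _
  have hHW : GeMod U H (conj W) := by
    refine ge_of_add_nonneg_of_left_eq hU hG hgood ?_ ?_ (fun _ => strong)
      (fun _ _ _ _ => (rightEndLike_conj.2 hWL).rightStrong) hH hHG.1
    · ext K; simp only [mem_left_conj, hWr]
    · ext K; simp only [mem_right_conj, hWl]
  have hW₁ : GeMod U W (conj H) := by simpa using hHW.conj hU.conj_mem
  have hW₂ : GeMod U (conj H) W :=
    ge_of_add_nonneg_of_left_eq hU hcG hgood' (by rw [conj_conj, hWl]) (by rw [conj_conj, hWr])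
      (fun _ => strong') (fun _ _ _ _ => hWR.rightStrong) hcH hHG'.1
  have hHW0 : GeMod U (H + W) 0 := by
    refine add_nonneg_of_left_eq hU hG hWl hWr (fun J hJ hJG X hX hXe => ?_) hH hHG.1
    have hJE := dom hG hH hJ (hU.conj_mem E hE) hHG hJG hEG'
    have hHF := dom hcG hcH hcH (hU.conj_mem F hF) hHG' hHG'.1 (conj_le hFG)
    -- Starting from a Left end-like sum, replace `conj F` by `conj H`, `conj E` by `J`, then `conj
    -- H` by `W`. Since `W` need not lie in `U`, it only enters last, with the context `J + X` in
    -- `U`.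
    have h₁ : (conj F + (conj E + X)).LeftWinsFirst := LeftEndLike.leftWinsFirst <|
      leftEndLike_add.2 ⟨leftEndLike_conj.2 hFe, leftEndLike_add.2 ⟨leftEndLike_conj.2 hEe, hXe⟩⟩
    have h₂ := hHF.left (hU.add_mem _ (hU.conj_mem E hE) _ hX) h₁
    rw [add_left_comm] at h₂
    have h₃ := hJE.left (hU.add_mem _ hcH _ hX) h₂
    rw [add_left_comm] at h₃
    have h₄ := hW₁.left (hU.add_mem _ hJ _ hX) h₃
    rwa [add_left_comm, ← add_assoc] at h₄
  have hHH : EqMod U (H + conj H) 0 := by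
    refine eqMod_zero_of_ge hU.conj_mem (GeMod.trans ?_ hHW0)
    rw [add_comm, add_comm H]
    exact hW₂.add_right hU.add_mem hH
  -- Both `H` and `conj G` are inverses of `conj H`.
  have hcGH : EqMod U H (conj G) := by
    have h₁ := hHG'.add_right hU.add_mem hH
    have h₂ := hHH.add_right hU.add_mem hcG
    rw [zero_add] at h₁ h₂
    rw [add_assoc, add_comm H, add_comm (conj H) (conj G)] at h₂
    rw [add_comm (conj H) (conj G)] at h₁
    exact h₁.symm.trans h₂
  have h₁ := hcGH.add_right hU.add_mem hG
  rw [add_comm (conj G)] at h₁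
  exact hbad (h₁.symm.trans hHG)

/-! ### 𝒫-free forms -/

theorem PFree.of_isOption {G' : Form} (h : PFree G) (hG' : IsOption G' G) : PFree G' :=
  fun K hK => h K (hK.tail hG')

theorem PFree.conj (h : PFree G) : PFree (conj G) := by
  intro K hK
  have hK' := Relation.ReflTransGen.lift Form.conj (fun _ _ => IsOption.conj) _ _ hK
  have := h (Form.conj K) (by simpa [Function.onFun, Subposition] using hK')
  rw [ne_eq, outcome_eq_P_iff] at this ⊢
  simpa [and_comm] using this

/-- 𝒫-freeness is hereditary, so the invertibility hypothesis reaches every subposition;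
invertibility alone need not, and the induction would break. -/
theorem add_conj_eqMod_zero_of_pFree (hU : IsUniverse U)
    (hinv : ∀ G ∈ PF U, ∃ H ∈ U, EqMod U (G + H) 0) (hG : G ∈ PF U) :
    EqMod U (G + conj G) 0 := by
  induction G using wf_isOption.transGen.induction with
  | _ G ih =>
    have hsub : ∀ G', Relation.TransGen IsOption G' G → G' ∈ PF U := by
      intro G' h
      induction h using Relation.TransGen.head_induction_on with
      | single h => exact ⟨hU.hereditary _ hG.1 _ h, hG.2.of_isOption h⟩
      | head h _ ih => exact ⟨hU.hereditary _ ih.1 _ h, ih.2.of_isOption h⟩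
    obtain ⟨H, hH, h⟩ := hinv G hG
    rw [add_comm] at h
    exact add_conj_eqMod_zero hU hG.1 (fun G' h' => ih G' h' (hsub G' h')) hH h

/-- Testing the equivalence against a form of `U` without options recovers the outcomes themselves.
-/
theorem EqMod.outcome_ne_P (hU : IsUniverse U) (h : EqMod U G H) (hG : outcome G ≠ Outcome.P) :
    outcome H ≠ Outcome.P := by
  obtain ⟨E, hE, hEl, hEr⟩ := exists_no_options hU
  rw [ne_eq, outcome_eq_P_iff] at hG ⊢
  have hw := fun X : Form => winsFirst_add_of_no_options hEl hEr X
  have h₁ := geMod_iff.1 h.1 E hE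
  have h₂ := geMod_iff.1 h.2 E hE
  rw [add_comm G, add_comm H, (hw G).1, (hw G).2, (hw H).1, (hw H).2] at h₁ h₂
  tauto

theorem subposition_add {K : Form} (h : Subposition K (G + H)) :
    ∃ G' H', Subposition G' G ∧ Subposition H' H ∧ K = G' + H' := by
  induction h using Relation.ReflTransGen.head_induction_on with
  | refl => exact ⟨G, H, .refl, .refl, rfl⟩
  | head h _ ih =>
    obtain ⟨G', H', hG', hH', rfl⟩ := ih
    rcases h with h | h
    · rcases mem_left_add.1 h with ⟨G'', h', rfl⟩ | ⟨H'', h', rfl⟩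
      · exact ⟨G'', H', .head (Or.inl h') hG', hH', rfl⟩
      · exact ⟨G', H'', hG', .head (Or.inl h') hH', rfl⟩
    · rcases mem_right_add.1 h with ⟨G'', h', rfl⟩ | ⟨H'', h', rfl⟩
      · exact ⟨G'', H', .head (Or.inr h') hG', hH', rfl⟩
      · exact ⟨G', H'', hG', .head (Or.inr h') hH', rfl⟩

theorem PFree.add (hU : IsUniverse U)
    (hadd : ∀ G ∈ PF U, ∀ H ∈ PF U, ∃ K ∈ PF U, EqMod U K (G + H)) (hG : G ∈ PF U)
    (hH : H ∈ PF U) : PFree (G + H) := by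
  have hsub : ∀ {G G' : Form}, G ∈ PF U → Subposition G' G → G' ∈ PF U := by
    intro G G' hG h
    induction h using Relation.ReflTransGen.head_induction_on with
    | refl => exact hG
    | head h _ ih => exact ⟨hU.hereditary _ ih.1 _ h, ih.2.of_isOption h⟩
  intro K hK
  obtain ⟨G', H', hG', hH', rfl⟩ := subposition_add hK
  obtain ⟨K, hK, h⟩ := hadd G' (hsub hG hG') H' (hsub hH hH')
  exact h.outcome_ne_P hU (hK.2 K .refl)

end Form

end Misere

-- Transfer from the universe to a conjugate-closed submonoid

theorem mainTheorem10 (U A : Set Form) (hU : IsUniverse U)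
    (hPF : IsSubgroupMod U (PF U) (Invertibles U) ∨ IsSubgroupMod U (PFMod U U) (Invertibles U))
    (hA : IsMonoidOfGames A) (hconj : ConjClosed A) (hAU : A ⊆ U) :
    (PF A = ∅ ∨ (IsSubgroupMod A (PF A) (ConjInvertibles A) ∧ AddClosed (PF A))) ∧
    (PFMod A A = ∅ ∨ (IsSubgroupMod A (PFMod A A) (ConjInvertibles A) ∧
      AddClosed (PFMod A A))) := by
  have hsub : PF U ⊆ PFMod U U := fun G hG => ⟨hG.1, G, hG.1, hG.2, Form.EqMod.refl U G⟩
  have hinv : ∀ G ∈ PF U, ∃ H ∈ U, Form.EqMod U (G + H) 0 := by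
    intro G hG
    rcases hPF with h | h
    · exact (h.subset hG).2
    · exact (h.subset (hsub hG)).2
  have hadd : ∀ G ∈ PF U, ∀ H ∈ PF U, ∃ K ∈ PF U, Form.EqMod U K (G + H) := by
    intro G hG H hH
    rcases hPF with h | h
    · exact h.add G hG H hH
    · obtain ⟨K, ⟨-, K', hK', hKf, hKK'⟩, hK⟩ := h.add G (hsub hG) H (hsub hH)
      -- The class of the sum is represented by `K'`, which is strictly 𝒫-free.
      exact ⟨K', ⟨hK', hKf⟩, hKK'.symm.trans hK⟩
  have hAPF : ∀ G ∈ PF A, G ∈ PF U := fun G hG => ⟨hAU hG.1, hG.2⟩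
  have hzero : ∀ G ∈ PF A, Form.EqMod A (G + Form.conj G) 0 := fun G hG =>
    (Form.add_conj_eqMod_zero_of_pFree hU hinv (hAPF G hG)).mono hAU
  have hconjPF : ∀ G ∈ PF A, Form.conj G ∈ PF A := fun G hG => ⟨hconj G hG.1, hG.2.conj⟩
  have haddPF : AddClosed (PF A) := fun G hG H hH =>
    ⟨hA.add_mem G hG.1 H hH.1, Form.PFree.add hU hadd (hAPF G hG) (hAPF H hH)⟩
  have haddMod : AddClosed (PFMod A A) := by
    rintro G ⟨hG, G₀, hG₀, hGf, hGG₀⟩ H ⟨hH, H₀, hH₀, hHf, hHH₀⟩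
    have h₀ := haddPF G₀ ⟨hG₀, hGf⟩ H₀ ⟨hH₀, hHf⟩
    exact ⟨hA.add_mem G hG H hH, _, h₀.1, h₀.2, hGG₀.add hA.add_mem hHH₀ hH hG₀⟩
  have hzeroMod : ∀ G ∈ PFMod A A, Form.EqMod A (G + Form.conj G) 0 := by
    rintro G ⟨hG, G₀, hG₀, hGf, hGG₀⟩
    exact (hGG₀.add hA.add_mem (hGG₀.conj hconj) (hconj G hG) hG₀).trans (hzero G₀ ⟨hG₀, hGf⟩)
  have hconjMod : ∀ G ∈ PFMod A A, Form.conj G ∈ PFMod A A := by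
    rintro G ⟨hG, G₀, hG₀, hGf, hGG₀⟩
    exact ⟨hconj G hG, Form.conj G₀, hconj G₀ hG₀, hGf.conj, hGG₀.conj hconj⟩
  constructor
  · refine (Set.eq_empty_or_nonempty (PF A)).imp_right fun ⟨G, hG⟩ => ⟨⟨?_, ?_, ?_, ?_⟩, haddPF⟩
    · exact fun G hG => ⟨hG.1, hconj G hG.1, hzero G hG⟩
    · exact fun G hG H hH => ⟨G + H, haddPF G hG H hH, Form.EqMod.refl A _⟩
    -- The form `0` itself may be absent from `A`; `G + conj G` represents its class.
    · exact ⟨_, haddPF G hG _ (hconjPF G hG), hzero G hG⟩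
    · exact fun G hG => ⟨_, hconjPF G hG, hzero G hG⟩
  · refine (Set.eq_empty_or_nonempty (PFMod A A)).imp_right
      fun ⟨G, hG⟩ => ⟨⟨?_, ?_, ?_, ?_⟩, haddMod⟩
    · exact fun G hG => ⟨hG.1, hconj G hG.1, hzeroMod G hG⟩
    · exact fun G hG H hH => ⟨G + H, haddMod G hG H hH, Form.EqMod.refl A _⟩
    · exact ⟨_, haddMod G hG _ (hconjMod G hG), hzeroMod G hG⟩
    · exact fun G hG => ⟨_, hconjMod G hG, hzeroMod G hG⟩
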